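/- Let $\mathbb{H}$ be the complex upper half plane, $W_2=\begin{pmatrix}0&-1/\sqrt2\\ \sqrt2&0\end{pmatrix}$, and let $\Gamma_0^*(2)=\Gamma_0(2)\cup\Gamma_0(2)W_2$ be the Fricke group of level $2$. For an even integer $k$ let $M_{k,2}$ be the complex vector space of (holomorphic) modular forms of weight $k$ for $\Gamma_0^*(2)$ (holomorphic at the cusps), and let $M^0_{k,2}\subseteq M_{k,2}$ be the subspace of cusp forms. For even $k\ge 4$ let $$E_k(z)=\frac12\sum_{(c,d)=1}(cz+d)^{-k},\qquad E^*_{k,2}(z)=\frac{2^{k/2}E_k(2z)+E_k(z)}{2^{k/2}+1}\qquad(z\in\mathbb{H}),$$ where the sum runs over all pairs of coprime integers $(c,d)$, and put $E^*_{0,2}=1$. Let $$\Delta_2=\frac{17}{1152}\left((E^*_{4,2})^2-E^*_{8,2}\right).$$ Then, for every even integer $k$: 1. If $k<0$ or $k=2$, then $M_{k,2}=0$. 2. If $k\in\{0,4,6,10\}$, then $M^0_{k,2}=0$, and $M_{k,2}=\mathbb{C}\,E^*_{k,2}$ has dimension $1$. 3. $M^0_{k,2}=\Delta_2\,M_{k-8,2}=\{\Delta_2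 g : g\in M_{k-8,2}\}$. 4. If $k\ge 0$, then $M_{k,2}$ is finite-dimensional, and $\dim M_{k,2}=\lfloor k/8\rfloor$ if $k\equiv 2\pmod 8$, while $\dim M_{k,2}=\lfloor k/8\rfloor+1$ if $k\not\equiv 2\pmod 8$. -/

import Mathlib

open UpperHalfPlane
open scoped MatrixGroups

/-- The matrix `W_p = (0, -1/√p; √p, 0)`, as an element of `GL(2, ℝ)`. -/
noncomputable def frickeW (p : ℕ) [NeZero p] : GL (Fin 2) ℝ :=
  Matrix.GeneralLinearGroup.mkOfDetNeZero !![0, -1 / √(p : ℝ); √(p : ℝ), 0] (by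
    have h : √(p : ℝ) ≠ 0 := Real.sqrt_ne_zero'.mpr (by exact_mod_cast Nat.pos_of_neZero p)
    simp [Matrix.det_fin_two, h])

/-- The matrix `W_p γ W_p⁻¹ = (d, -c/p; -p b, a)` for `γ = (a, b; c, d) ∈ Γ₀(p)`. -/
def frickeConj (p : ℕ) (γ : SL(2, ℤ)) (h : γ ∈ CongruenceSubgroup.Gamma0 p) : SL(2, ℤ) :=
  ⟨!![γ 1 1, -(γ 1 0 / p); -(p * γ 0 1), γ 0 0], by
    have h1 : (p : ℤ) ∣ γ 1 0 := by
      rw [CongruenceSubgroup.Gamma0_mem] at h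
      exact (ZMod.intCast_zmod_eq_zero_iff_dvd _ _).mp h
    have h2 := γ.det_coe
    have h3 := Int.ediv_mul_cancel h1
    rw [Matrix.det_fin_two] at h2 ⊢
    simp only [Matrix.of_apply, Matrix.cons_val', Matrix.cons_val_zero, Matrix.cons_val_one,
      Matrix.cons_val_fin_one]
    linear_combination h2 - γ 0 1 * h3⟩

theorem frickeConj_mem (p : ℕ) (γ : SL(2, ℤ)) (h : γ ∈ CongruenceSubgroup.Gamma0 p) :
    frickeConj p γ h ∈ CongruenceSubgroup.Gamma0 p := by
  rw [CongruenceSubgroup.Gamma0_mem, show frickeConj p γ h 1 0 = -(p * γ 0 1) from rfl]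
  simp

theorem frickeW_mul (p : ℕ) [NeZero p] (γ : SL(2, ℤ)) (h : γ ∈ CongruenceSubgroup.Gamma0 p) :
    frickeW p * Matrix.SpecialLinearGroup.mapGL ℝ γ =
      Matrix.SpecialLinearGroup.mapGL ℝ (frickeConj p γ h) * frickeW p := by
  have hp : (0 : ℝ) < p := by exact_mod_cast Nat.pos_of_neZero p
  have hs : √(p : ℝ) ≠ 0 := Real.sqrt_ne_zero'.mpr hp
  have hq : √(p : ℝ) ^ 2 = p := Real.sq_sqrt hp.le
  have h1 : (p : ℤ) ∣ γ 1 0 := by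
    rw [CongruenceSubgroup.Gamma0_mem] at h
    exact (ZMod.intCast_zmod_eq_zero_iff_dvd _ _).mp h
  have h3 : ((γ 1 0 / (p : ℤ) : ℤ) : ℝ) * p = (γ 1 0 : ℝ) := by
    exact_mod_cast Int.ediv_mul_cancel h1
  have c00 : frickeConj p γ h 0 0 = γ 1 1 := rfl
  have c01 : frickeConj p γ h 0 1 = -(γ 1 0 / p) := rfl
  have c10 : frickeConj p γ h 1 0 = -(p * γ 0 1) := rfl
  have c11 : frickeConj p γ h 1 1 = γ 0 0 := rfl
  ext i j
  fin_cases i <;> fin_cases j <;>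
    simp [frickeW, Matrix.mul_apply, Fin.sum_univ_two, c00, c01, c10, c11,
      Matrix.GeneralLinearGroup.mkOfDetNeZero] <;> field_simp
  · rw [← h3, hq, mul_comm]
  · rw [hq, mul_comm]

theorem frickeW_mul_self (p : ℕ) [NeZero p] :
    frickeW p * frickeW p = Matrix.SpecialLinearGroup.mapGL ℝ (-1 : SL(2, ℤ)) := by
  have hp : (0 : ℝ) < p := by exact_mod_cast Nat.pos_of_neZero p
  have hs : √(p : ℝ) ≠ 0 := Real.sqrt_ne_zero'.mpr hp
  ext i j
  fin_cases i <;> fin_cases j <;>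
    simp [frickeW, Matrix.mul_apply, Fin.sum_univ_two,
      Matrix.GeneralLinearGroup.mkOfDetNeZero] <;> field_simp

theorem neg_one_mem_Gamma0 (p : ℕ) : (-1 : SL(2, ℤ)) ∈ CongruenceSubgroup.Gamma0 p := by
  simp [CongruenceSubgroup.Gamma0_mem]

/-- The Fricke group `Γ₀*(p) = Γ₀(p) ∪ Γ₀(p) W_p`, as a subgroup of `GL(2, ℝ)`. -/
noncomputable def frickeGroup (p : ℕ) [NeZero p] : Subgroup (GL (Fin 2) ℝ) where
  carrier := {g | ∃ γ ∈ CongruenceSubgroup.Gamma0 p,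
    g = Matrix.SpecialLinearGroup.mapGL ℝ γ ∨
      g = Matrix.SpecialLinearGroup.mapGL ℝ γ * frickeW p}
  one_mem' := ⟨1, one_mem _, Or.inl (map_one _).symm⟩
  mul_mem' := by
    rintro _ _ ⟨γ, hγ, rfl | rfl⟩ ⟨δ, hδ, rfl | rfl⟩
    · exact ⟨γ * δ, mul_mem hγ hδ, Or.inl (map_mul _ _ _).symm⟩
    · exact ⟨γ * δ, mul_mem hγ hδ, Or.inr (by rw [map_mul, mul_assoc])⟩
    · exact ⟨γ * frickeConj p δ hδ, mul_mem hγ (frickeConj_mem p δ hδ),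
        Or.inr (by rw [mul_assoc, frickeW_mul p δ hδ, map_mul, mul_assoc])⟩
    · refine ⟨γ * frickeConj p δ hδ * -1, mul_mem (mul_mem hγ (frickeConj_mem p δ hδ))
        (neg_one_mem_Gamma0 p), Or.inl ?_⟩
      rw [map_mul, map_mul, ← frickeW_mul_self p, mul_assoc, ← mul_assoc (frickeW p),
        frickeW_mul p δ hδ]
      simp only [mul_assoc]
  inv_mem' := by
    rintro _ ⟨γ, hγ, rfl | rfl⟩
    · exact ⟨γ⁻¹, inv_mem hγ, Or.inl (map_inv _ _).symm⟩
    · refine ⟨-1 * frickeConj p γ⁻¹ (inv_mem hγ),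
        mul_mem (neg_one_mem_Gamma0 p) (frickeConj_mem p _ _), Or.inr ?_⟩
      have h4 : frickeW p * (frickeW p * frickeW p * frickeW p) = 1 := by
        rw [mul_assoc (frickeW p), frickeW_mul_self, ← mul_assoc, frickeW_mul_self, ← map_mul]
        simp
      rw [map_mul, mul_assoc, ← frickeW_mul p γ⁻¹ (inv_mem hγ), ← frickeW_mul_self p, mul_inv_rev,
        ← map_inv, inv_eq_of_mul_eq_one_right h4]
      simp only [mul_assoc]

/-- Every element of `Γ₀*(p)` has determinant one; this makes the spaces of modular forms for
`Γ₀*(p)` complex vector spaces. -/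
instance frickeGroup_hasDetOne (p : ℕ) [NeZero p] : (frickeGroup p).HasDetOne where
  det_eq := by
    have hp : (0 : ℝ) < p := by exact_mod_cast Nat.pos_of_neZero p
    have hs : √(p : ℝ) ≠ 0 := Real.sqrt_ne_zero'.mpr hp
    have hW : Matrix.GeneralLinearGroup.det (frickeW p) = 1 := by
      ext
      simp [frickeW, Matrix.GeneralLinearGroup.mkOfDetNeZero, Matrix.det_fin_two, hs]
    rintro _ ⟨γ, hγ, rfl | rfl⟩
    · simp
    · simp [hW]

/-- `M_{k,p}`: the space of modular forms of weight `k` for `Γ₀*(p)`, as a space of functions. -/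
noncomputable def frickeModularForms (p : ℕ) [NeZero p] (k : ℤ) : Submodule ℂ (ℍ → ℂ) where
  carrier := Set.range fun f : ModularForm (frickeGroup p) k => (f : ℍ → ℂ)
  zero_mem' := ⟨0, rfl⟩
  add_mem' := by rintro _ _ ⟨f, rfl⟩ ⟨g, rfl⟩; exact ⟨f + g, rfl⟩
  smul_mem' := by rintro c _ ⟨f, rfl⟩; exact ⟨c • f, rfl⟩

/-- `M⁰_{k,p}`: the space of cusp forms of weight `k` for `Γ₀*(p)`, as a space of functions. -/
noncomputable def frickeCuspForms (p : ℕ) [NeZero p] (k : ℤ) : Submodule ℂ (ℍ → ℂ) where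
  carrier := Set.range fun f : CuspForm (frickeGroup p) k => (f : ℍ → ℂ)
  zero_mem' := ⟨0, rfl⟩
  add_mem' := by rintro _ _ ⟨f, rfl⟩ ⟨g, rfl⟩; exact ⟨f + g, rfl⟩
  smul_mem' := by rintro c _ ⟨f, rfl⟩; exact ⟨c • f, rfl⟩

/-- The normalised Eisenstein series `E_k(z) = (1/2) ∑_{(c,d)=1} (c z + d)^{-k}` of `SL(2, ℤ)`
(used for even `k ≥ 4`), together with the convention `E_0 = 1`. -/
noncomputable def eisE (k : ℤ) (z : ℍ) : ℂ :=
  if k = 0 then 1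
  else (1 / 2) * ∑' v : {v : Fin 2 → ℤ // IsCoprime (v 0) (v 1)},
    ((v.1 0 : ℂ) * z + (v.1 1 : ℂ)) ^ (-k)

/-- For weights at least `3`, `eisE` is Mathlib's normalised Eisenstein series. -/
theorem eisE_eq_E {k : ℕ} (hk : 3 ≤ k) : eisE k = ⇑(ModularForm.E hk) := by
  ext z
  have h0 : (k : ℤ) ≠ 0 := by omega
  have h : {v : Fin 2 → ℤ | IsCoprime (v 0) (v 1)} = EisensteinSeries.gammaSet 1 1 0 :=
    Set.ext fun v => (EisensteinSeries.mem_gammaSet_one v).symm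
  change _ = (1 / 2 : ℂ) * ∑' v : EisensteinSeries.gammaSet 1 1 0, _
  rw [eisE, if_neg h0, ← h]
  rfl

/-- The point `p z` of the upper half plane. -/
def natMulUHP (p : ℕ) [NeZero p] (z : ℍ) : ℍ :=
  ⟨(p : ℂ) * z, by simpa using mul_pos (Nat.cast_pos.mpr (Nat.pos_of_neZero p)) z.im_pos⟩

/-- The Eisenstein series
`E*_{k,p}(z) = (p^{k/2} E_k(p z) + E_k(z)) / (p^{k/2} + 1)` of `Γ₀*(p)`, for even `k`. -/
noncomputable def frickeE (p : ℕ) [NeZero p] (k : ℤ) (z : ℍ) : ℂ :=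
  1 / ((p : ℂ) ^ (k / 2) + 1) * ((p : ℂ) ^ (k / 2) * eisE k (natMulUHP p z) + eisE k z)

/-- With the convention `E_0 = 1` also `E*_{0,p} = 1`. -/
theorem frickeE_zero (p : ℕ) [NeZero p] : frickeE p 0 = 1 := by
  ext z
  norm_num [frickeE, eisE]

/-- `Δ₂ = (17/1152) ((E*_{4,2})² - E*_{8,2})`. -/
noncomputable def frickeDelta : ℍ → ℂ :=
  (17 / 1152 : ℂ) • (frickeE 2 4 ^ 2 - frickeE 2 8)

/-! `Γ₀*(2)` has one cusp, so its forms are the invariant holomorphic functions bounded at infinity.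
The heart of the matter is that `Δ₂` is a cusp form without zeros on `ℍ` and with a simple zero at
the cusp. In place of a valence formula, `Δ₂` is compared with `Δ · Δ|W = 64 Δ(z) Δ(2z)`, which has
weight 24, no zeros on `ℍ`, and order 3 in `q`. The quotient `Δ₂³ / (Δ · Δ|W)` is a form of weight
0, hence constant, and nonzero because `Δ₂ = q + ⋯` (`exists_frickeDelta_pow_three`).

Division by `Δ₂` then identifies cusp forms of weight `k` with forms of weight `k - 8`
(`frickeCuspForms_eq_map`). For `k = 0` and `k ≥ 4` the series `E*_{k,2}` splits off the value at
the cusp, so the dimension grows by one at each step of 8. The recursion starts from the vanishing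
in negative weight and in weight 2. In weight 2 a form vanishes at the fixed point of `W`, where
`E*_{4,2}` does not (`frickeModularForms_two`). -/

open Matrix.SpecialLinearGroup CongruenceSubgroup Filter Topology
open scoped Manifold ModularForm

/-! ### Arithmeticity and the single cusp of the Fricke group -/

theorem mapGL_mem_frickeGroup {p : ℕ} [NeZero p] {γ : SL(2, ℤ)} (h : γ ∈ Gamma0 p) :
    mapGL ℝ γ ∈ frickeGroup p :=
  ⟨γ, h, Or.inl rfl⟩

theorem frickeW_mem_frickeGroup (p : ℕ) [NeZero p] : frickeW p ∈ frickeGroup p :=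
  ⟨1, one_mem _, Or.inr (by simp)⟩

theorem map_Gamma0_le_frickeGroup (p : ℕ) [NeZero p] :
    ((Gamma0 p : Subgroup SL(2, ℤ)) : Subgroup (GL (Fin 2) ℝ)) ≤ frickeGroup p := by
  rintro _ ⟨γ, hγ, rfl⟩
  exact mapGL_mem_frickeGroup hγ

theorem relIndex_Gamma0_frickeGroup_ne_zero (p : ℕ) [NeZero p] :
    ((Gamma0 p : Subgroup SL(2, ℤ)) : Subgroup (GL (Fin 2) ℝ)).relIndex (frickeGroup p) ≠ 0 := by
  set Γ := ((Gamma0 p : Subgroup SL(2, ℤ)) : Subgroup (GL (Fin 2) ℝ))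
  have key : ∀ b ∈ frickeGroup p, b * frickeW p ∈ Γ ∨ b ∈ Γ := by
    rintro _ ⟨γ, hγ, rfl | rfl⟩
    · exact Or.inr ⟨γ, hγ, rfl⟩
    · refine Or.inl ⟨γ * -1, mul_mem hγ (neg_one_mem_Gamma0 p), ?_⟩
      rw [mul_assoc, frickeW_mul_self, ← map_mul]
  -- For `p = 1` the matrix `W` already lies in `Γ₀(p)`, so the index can be 1 as well as 2.
  by_cases hW : frickeW p ∈ Γ
  · have hle : frickeGroup p ≤ Γ := fun b hb ↦
      (key b hb).elim (fun h ↦ by simpa using mul_mem h (inv_mem hW)) id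
    simp [Subgroup.relIndex_eq_one.mpr hle]
  · have := Subgroup.relIndex_eq_two_iff_exists_notMem_and.mpr
      ⟨frickeW p, frickeW_mem_frickeGroup p, hW, key⟩
    simp [this]

instance frickeGroup_isArithmetic (p : ℕ) [NeZero p] : (frickeGroup p).IsArithmetic := by
  have hΓ : Subgroup.Commensurable
      ((Gamma0 p : Subgroup SL(2, ℤ)) : Subgroup (GL (Fin 2) ℝ)) (frickeGroup p) :=
    ⟨relIndex_Gamma0_frickeGroup_ne_zero p,
      by simp [Subgroup.relIndex_eq_one.mpr (map_Gamma0_le_frickeGroup p)]⟩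
  exact ⟨hΓ.symm.trans Subgroup.IsArithmetic.is_commensurable⟩

theorem one_mem_strictPeriods_frickeGroup (p : ℕ) [NeZero p] :
    (1 : ℝ) ∈ (frickeGroup p).strictPeriods := by
  have h : (1 : ℝ) ∈ ((Gamma0 p : Subgroup SL(2, ℤ)) : Subgroup (GL (Fin 2) ℝ)).strictPeriods := by
    rw [strictPeriods_Gamma0]
    exact AddSubgroup.mem_zmultiples 1
  rw [Subgroup.mem_strictPeriods_iff] at h ⊢
  exact map_Gamma0_le_frickeGroup p h

/-- The Fricke group of level two has a single cusp. -/
theorem exists_smul_infty_of_isCusp {c : OnePoint ℝ} (hc : IsCusp c (frickeGroup 2)) :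
    ∃ g ∈ frickeGroup 2, g • OnePoint.infty = c := by
  rw [Subgroup.IsArithmetic.isCusp_iff_isCusp_SL2Z, isCusp_SL2Z_iff'] at hc
  obtain ⟨γ, rfl⟩ := hc
  by_cases h : (2 : ℤ) ∣ γ 1 0
  · exact ⟨_, mapGL_mem_frickeGroup (Gamma0_mem.mpr
      ((ZMod.intCast_zmod_eq_zero_iff_dvd _ _).mpr h)), rfl⟩
  · have hdet := γ.det_coe
    rw [Matrix.det_fin_two] at hdet
    obtain ⟨m, hm⟩ : ∃ m : ℤ, (2 : ℤ) ∣ γ 1 1 + m * γ 1 0 := by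
      rcases Int.even_or_odd (γ 1 1) with h1 | h1
      · exact ⟨0, by simpa using h1.two_dvd⟩
      · exact ⟨1, by
          have h2 : Odd (γ 1 0) := Int.not_even_iff_odd.mp (fun h2 ↦ h h2.two_dvd)
          simpa using (h1.add_odd h2).two_dvd⟩
    -- `δ = γ T^m S`, with `m` chosen to make its lower left entry even. Since `W ∞ = 0` and `T^m S
    -- 0 = ∞`, `δ W ∞ = γ ∞`.
    let δ : SL(2, ℤ) := ⟨!![γ 0 1 + m * γ 0 0, -γ 0 0; γ 1 1 + m * γ 1 0, -γ 1 0], by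
      rw [Matrix.det_fin_two]
      simp only [Matrix.of_apply, Matrix.cons_val', Matrix.cons_val_zero, Matrix.cons_val_one,
        Matrix.cons_val_fin_one]
      linear_combination hdet⟩
    have hδ : δ ∈ Gamma0 2 := Gamma0_mem.mpr ((ZMod.intCast_zmod_eq_zero_iff_dvd _ _).mpr hm)
    refine ⟨mapGL ℝ δ * frickeW 2, mul_mem (mapGL_mem_frickeGroup hδ)
      (frickeW_mem_frickeGroup 2), ?_⟩
    have d00 : δ 0 0 = γ 0 1 + m * γ 0 0 := rfl
    have d01 : δ 0 1 = -γ 0 0 := rfl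
    have d10 : δ 1 0 = γ 1 1 + m * γ 1 0 := rfl
    have d11 : δ 1 1 = -γ 1 0 := rfl
    have hc0 : (γ 1 0 : ℝ) ≠ 0 := by
      intro h0
      apply h
      rw [Int.cast_eq_zero.mp h0]
      exact dvd_zero 2
    rw [OnePoint.smul_infty_eq_ite, OnePoint.smul_infty_eq_ite]
    simp [frickeW, Matrix.mul_apply, Fin.sum_univ_two, d00, d01, d10, d11,
      Matrix.GeneralLinearGroup.mkOfDetNeZero, hc0]
    exact mul_div_mul_right _ _ (by simp)

/-! ### Modular forms and cusp forms in terms of behaviour at infinity -/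

/-- Modular forms for the Fricke group of level two are the invariant holomorphic functions that
are bounded at infinity. -/
theorem mem_frickeModularForms_iff {k : ℤ} {f : ℍ → ℂ} :
    f ∈ frickeModularForms 2 k ↔
      (∀ g ∈ frickeGroup 2, f ∣[k] g = f) ∧ MDiff f ∧ IsBoundedAtImInfty f := by
  constructor
  · rintro ⟨f, rfl⟩
    exact ⟨f.slash_action_eq', f.holo', OnePoint.isBoundedAt_infty_iff.mp
      (f.bdd_at_cusps' (Subgroup.isCusp_of_mem_strictPeriods one_pos
        (one_mem_strictPeriods_frickeGroup 2)))⟩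
  · rintro ⟨h1, h2, h3⟩
    refine ⟨{ toFun := f, slash_action_eq' := h1, holo' := h2, bdd_at_cusps' := fun hc ↦ ?_ }, rfl⟩
    obtain ⟨g, hg, rfl⟩ := exists_smul_infty_of_isCusp hc
    rw [OnePoint.IsBoundedAt.smul_iff, OnePoint.isBoundedAt_infty_iff, h1 g hg]
    exact h3

theorem mem_frickeCuspForms_iff {k : ℤ} {f : ℍ → ℂ} :
    f ∈ frickeCuspForms 2 k ↔ f ∈ frickeModularForms 2 k ∧ IsZeroAtImInfty f := by
  rw [mem_frickeModularForms_iff]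
  constructor
  · rintro ⟨f, rfl⟩
    have h0 := OnePoint.isZeroAt_infty_iff.mp
      (f.zero_at_cusps' (Subgroup.isCusp_of_mem_strictPeriods one_pos
        (one_mem_strictPeriods_frickeGroup 2)))
    exact ⟨⟨f.slash_action_eq', f.holo', h0.isBoundedAtImInfty⟩, h0⟩
  · rintro ⟨⟨h1, h2, -⟩, h3⟩
    refine ⟨{ toFun := f, slash_action_eq' := h1, holo' := h2, zero_at_cusps' := fun hc ↦ ?_ }, rfl⟩
    obtain ⟨g, hg, rfl⟩ := exists_smul_infty_of_isCusp hc
    rw [OnePoint.IsZeroAt.smul_iff, OnePoint.isZeroAt_infty_iff, h1 g hg]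
    exact h3

theorem mul_slash_of_mem_frickeGroup {g : GL (Fin 2) ℝ} (hg : g ∈ frickeGroup 2) (a b : ℤ)
    (f h : ℍ → ℂ) : (f * h) ∣[a + b] g = f ∣[a] g * h ∣[b] g := by
  rw [ModularForm.mul_slash, Subgroup.HasDetOne.det_eq hg]
  simp

theorem mul_mem_frickeModularForms {a b : ℤ} {f g : ℍ → ℂ} (hf : f ∈ frickeModularForms 2 a)
    (hg : g ∈ frickeModularForms 2 b) : f * g ∈ frickeModularForms 2 (a + b) := by
  obtain ⟨f, rfl⟩ := hf
  obtain ⟨g, rfl⟩ := hg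
  exact ⟨f.mul g, rfl⟩

theorem one_mem_frickeModularForms : (1 : ℍ → ℂ) ∈ frickeModularForms 2 0 :=
  ⟨1, rfl⟩

theorem div_slash_of_mem_frickeGroup {g : GL (Fin 2) ℝ} (hg : g ∈ frickeGroup 2) (a b : ℤ)
    (f h : ℍ → ℂ) : (f / h) ∣[a - b] g = f ∣[a] g / h ∣[b] g := by
  ext τ
  have hdet : g.det.val = 1 := by simp [Subgroup.HasDetOne.det_eq hg]
  simp only [ModularForm.slash_apply, Pi.div_apply, map_div₀, hdet,
    zpow_neg, zpow_sub₀ (denom_ne_zero g τ)]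
  simp
  field_simp [denom_ne_zero g τ]

theorem frickeModularForms_eq_bot_of_neg {k : ℤ} (hk : k < 0) : frickeModularForms 2 k = ⊥ := by
  rw [eq_bot_iff]
  rintro _ ⟨f, rfl⟩
  rw [ModularForm.isZero_of_neg_weight hk f]
  rfl

theorem eq_const_of_mem_frickeModularForms_zero {f : ℍ → ℂ} (hf : f ∈ frickeModularForms 2 0) :
    ∃ c, f = Function.const ℍ c := by
  obtain ⟨f, rfl⟩ := hf
  exact f.eq_const_of_weight_zero

theorem isBigO_exp_of_mem_frickeCuspForms {k : ℤ} {f : ℍ → ℂ} (hf : f ∈ frickeCuspForms 2 k) :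
    f =O[atImInfty] fun τ ↦ Real.exp (-2 * Real.pi * τ.im) := by
  obtain ⟨f, rfl⟩ := hf
  simpa using CuspFormClass.exp_decay_atImInfty (h := 1) f one_pos
    (one_mem_strictPeriods_frickeGroup 2)

theorem exists_tendsto_of_mem_frickeModularForms {k : ℤ} {f : ℍ → ℂ}
    (hf : f ∈ frickeModularForms 2 k) : ∃ c, Tendsto f atImInfty (𝓝 c) := by
  obtain ⟨f, rfl⟩ := hf
  have hΓ := one_mem_strictPeriods_frickeGroup 2
  have h := ModularFormClass.analyticAt_cuspFunction_zero f one_pos hΓ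
  exact ⟨_, (h.continuousAt.tendsto.comp (qParam_tendsto_atImInfty one_pos)).congr
    (fun τ ↦ SlashInvariantFormClass.eq_cuspFunction f τ hΓ one_ne_zero)⟩

/-! ### The Fricke involution on level one forms, and Eisenstein series -/

theorem denom_frickeW (z : ℍ) : denom (frickeW 2) z = √2 * z := by
  simp [denom, frickeW, Matrix.GeneralLinearGroup.mkOfDetNeZero]

theorem det_frickeW : (frickeW 2).det = 1 :=
  Subgroup.HasDetOne.det_eq (frickeW_mem_frickeGroup 2)

theorem frickeW_smul (z : ℍ) : frickeW 2 • z = ModularGroup.S • natMulUHP 2 z := by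
  have hs : ((√2 : ℝ) : ℂ) ≠ 0 := by simp
  have hq : ((√2 : ℝ) : ℂ) ^ 2 = 2 := by
    rw [← Complex.ofReal_pow, Real.sq_sqrt (by norm_num)]; simp
  have hz := z.ne_zero
  apply UpperHalfPlane.ext
  rw [modular_S_smul, UpperHalfPlane.coe_smul_of_det_pos (by simp [det_frickeW]), denom_frickeW]
  simp only [natMulUHP, num, frickeW, Matrix.GeneralLinearGroup.mkOfDetNeZero]
  simp
  field_simp
  rw [hq]

theorem slash_frickeW_apply (k : ℤ) (f : ℍ → ℂ) (z : ℍ) :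
    (f ∣[k] frickeW 2) z = f (frickeW 2 • z) * (√2 * z : ℂ) ^ (-k) := by
  rw [ModularForm.slash_apply, denom_frickeW, det_frickeW]
  simp [σ, det_frickeW]

/-- On forms of level one, the Fricke involution acts as `f(z) ↦ 2^{m} f(2z)` in weight `2m`. -/
theorem levelOne_slash_frickeW {m : ℤ} {f : ℍ → ℂ} (hf : f ∣[m + m] ModularGroup.S = f) (z : ℍ) :
    (f ∣[m + m] frickeW 2) z = 2 ^ m * f (natMulUHP 2 z) := by
  have h := congrFun hf (natMulUHP 2 z)
  have hq : ((√2 : ℝ) : ℂ) * ((√2 : ℝ) : ℂ) = 2 := by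
    rw [← Complex.ofReal_mul, Real.mul_self_sqrt (by norm_num)]; simp
  have hz := z.ne_zero
  have hs : ((√2 : ℝ) : ℂ) ≠ 0 := by simp
  rw [ModularForm.SL_slash_apply, ModularGroup.denom_S] at h
  rw [slash_frickeW_apply, frickeW_smul, ← h, natMulUHP]
  simp only [Nat.cast_ofNat]
  rw [mul_left_comm]
  congr 1
  -- The automorphy factors of `S` at `2z` and of `W` at `z` are `2z` and `√2 z`; their squares
  -- differ by the factor 2, which yields `2^m` in weight `2m`.
  have h4 : (2 * z : ℂ) * (2 * z) = 2 * (√2 * z * (√2 * z)) := by linear_combination (-2 * z ^ 2) * hq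
  rw [neg_add, zpow_add₀ (mul_ne_zero hs hz), ← mul_zpow,
    zpow_add₀ (mul_ne_zero two_ne_zero hz), ← mul_zpow, h4, mul_zpow 2,
    ← mul_assoc ((2 : ℂ) ^ m),
    ← zpow_add₀ two_ne_zero, add_neg_cancel, zpow_zero, one_mul]

/-- `W` normalises `Γ₀(2)` and `W² = -1`, so the Fricke group either fixes or swaps `f` and `f|W`.
Hence `f + f|W` and `f · f|W` are invariant; these give the Eisenstein series and the weight 24 form
below. -/
theorem levelOne_slash_frickeW_slash {k : ℤ} {f : ℍ → ℂ} (hf : ∀ γ : SL(2, ℤ), f ∣[k] mapGL ℝ γ = f)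
    {g : GL (Fin 2) ℝ} (hg : g ∈ frickeGroup 2) :
    (f ∣[k] g = f ∧ (f ∣[k] frickeW 2) ∣[k] g = f ∣[k] frickeW 2) ∨
      (f ∣[k] g = f ∣[k] frickeW 2 ∧ (f ∣[k] frickeW 2) ∣[k] g = f) := by
  have h1 : ∀ γ ∈ Gamma0 2, (f ∣[k] frickeW 2) ∣[k] mapGL ℝ γ = f ∣[k] frickeW 2 := by
    intro γ hγ
    rw [← SlashAction.slash_mul, frickeW_mul 2 γ hγ, SlashAction.slash_mul, hf]
  obtain ⟨γ, hγ, rfl | rfl⟩ := hg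
  · exact Or.inl ⟨hf γ, h1 γ hγ⟩
  · refine Or.inr ⟨by rw [SlashAction.slash_mul, hf], ?_⟩
    rw [SlashAction.slash_mul, h1 γ hγ, ← SlashAction.slash_mul, frickeW_mul_self, hf]

theorem tendsto_natMulUHP (p : ℕ) [NeZero p] : Tendsto (natMulUHP p) atImInfty atImInfty := by
  have hp : (0 : ℝ) < p := by exact_mod_cast Nat.pos_of_neZero p
  rw [atImInfty, tendsto_comap_iff]
  have : im ∘ natMulUHP p = fun z ↦ (p : ℝ) * z.im := by
    ext z
    change ((p : ℂ) * z).im = _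
    simp
  rw [this]
  exact tendsto_comap.const_mul_atTop hp

theorem tendsto_E {k : ℕ} (hk : 3 ≤ k) (hk2 : Even k) :
    Tendsto (ModularForm.E hk) atImInfty (𝓝 1) := by
  have hΓ : (1 : ℝ) ∈ Subgroup.strictPeriods 𝒮ℒ := one_mem_strictPeriods_SL
  have h := ModularFormClass.analyticAt_cuspFunction_zero (ModularForm.E hk) one_pos hΓ
  have h0 : UpperHalfPlane.cuspFunction 1 (ModularForm.E hk) 0 = 1 := by
    have := EisensteinSeries.E_qExpansion_coeff_zero hk hk2
    simpa [qExpansion_coeff] using this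
  rw [← h0]
  exact (h.continuousAt.tendsto.comp (qParam_tendsto_atImInfty one_pos)).congr
    (fun τ ↦ SlashInvariantFormClass.eq_cuspFunction _ τ hΓ one_ne_zero)

theorem two_zpow_add_one_ne_zero (m : ℤ) : (2 : ℂ) ^ m + 1 ≠ 0 := by
  have h : (0 : ℝ) < 2 ^ m + 1 := by positivity
  have h' : (((2 : ℝ) ^ m + 1 : ℝ) : ℂ) ≠ 0 := Complex.ofReal_ne_zero.mpr h.ne'
  push_cast at h'
  exact h'

theorem frickeE_eq {k : ℕ} (hk : 3 ≤ k) (hk2 : Even k) :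
    frickeE 2 k = (1 / ((2 : ℂ) ^ ((k : ℤ) / 2) + 1)) •
      ((ModularForm.E hk : ℍ → ℂ) ∣[(k : ℤ)] frickeW 2 + ModularForm.E hk) := by
  obtain ⟨m, rfl⟩ := hk2
  ext z
  have hS : (ModularForm.E hk : ℍ → ℂ) ∣[(m : ℤ) + m] ModularGroup.S = ModularForm.E hk := by
    rw [← Nat.cast_add]
    exact (ModularForm.E hk).slash_action_eq' _ ⟨ModularGroup.S, rfl⟩
  have := levelOne_slash_frickeW hS z
  simp only [frickeE, eisE_eq_E hk, Pi.smul_apply, Pi.add_apply, smul_eq_mul]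
  push_cast at this ⊢
  rw [this, show ((m : ℤ) + m) / 2 = m by omega]

theorem frickeE_mem {k : ℕ} (hk : 3 ≤ k) (hk2 : Even k) :
    frickeE 2 k ∈ frickeModularForms 2 k ∧ Tendsto (frickeE 2 k) atImInfty (𝓝 1) := by
  have hlim : Tendsto (frickeE 2 k) atImInfty (𝓝 1) := by
    have h := tendsto_E hk hk2
    have h2 := h.comp (tendsto_natMulUHP 2)
    have h3 := ((h2.const_mul ((2 : ℂ) ^ ((k : ℤ) / 2))).add h).const_mul
      (1 / ((2 : ℂ) ^ ((k : ℤ) / 2) + 1))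
    rw [mul_one, one_div_mul_cancel (two_zpow_add_one_ne_zero _)] at h3
    refine h3.congr fun z ↦ ?_
    simp [frickeE, eisE_eq_E hk]
  refine ⟨mem_frickeModularForms_iff.mpr ⟨?_, ?_, hlim.isBigO_one ℝ⟩, hlim⟩
  · intro g hg
    have hf : ∀ γ : SL(2, ℤ), (ModularForm.E hk : ℍ → ℂ) ∣[(k : ℤ)] mapGL ℝ γ = ModularForm.E hk :=
      fun γ ↦ (ModularForm.E hk).slash_action_eq' _ ⟨γ, rfl⟩
    have hσ : ∀ c : ℂ, σ g c = c := fun c ↦ by simp [σ, Subgroup.HasDetOne.det_eq hg]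
    rw [frickeE_eq hk hk2, ModularForm.smul_slash, hσ, SlashAction.add_slash]
    rcases levelOne_slash_frickeW_slash hf hg with ⟨h1, h2⟩ | ⟨h1, h2⟩
    · rw [h1, h2]
    · rw [h1, h2, add_comm (ModularForm.E hk : ℍ → ℂ)]
  · rw [frickeE_eq hk hk2]
    exact (((ModularForm.E hk).holo'.slash _ _).add (ModularForm.E hk).holo').const_smul _

/-! ### A zero-free comparison form of weight 24 -/

/-- The weight 24 form `Δ · Δ|W` for the Fricke group, where `Δ` is the discriminant. -/
noncomputable def frickeDiscriminant : ℍ → ℂ :=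
  ModularForm.discriminant * ModularForm.discriminant ∣[(12 : ℤ)] frickeW 2

theorem discriminant_slash (γ : SL(2, ℤ)) :
    ModularForm.discriminant ∣[(12 : ℤ)] mapGL ℝ γ = ModularForm.discriminant :=
  CuspForm.discriminant.slash_action_eq' _ ⟨γ, rfl⟩

theorem discriminant_slash_frickeW (z : ℍ) :
    (ModularForm.discriminant ∣[(12 : ℤ)] frickeW 2) z =
      64 * ModularForm.discriminant (natMulUHP 2 z) := by
  have := levelOne_slash_frickeW (m := 6) (f := ModularForm.discriminant)
    (discriminant_slash ModularGroup.S) z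
  norm_num at this ⊢
  exact this

theorem frickeDiscriminant_ne_zero (z : ℍ) : frickeDiscriminant z ≠ 0 := by
  rw [frickeDiscriminant, Pi.mul_apply, discriminant_slash_frickeW]
  exact mul_ne_zero (ModularForm.discriminant_ne_zero _)
    (mul_ne_zero (by norm_num) (ModularForm.discriminant_ne_zero _))

theorem frickeDiscriminant_slash {g : GL (Fin 2) ℝ} (hg : g ∈ frickeGroup 2) :
    frickeDiscriminant ∣[(24 : ℤ)] g = frickeDiscriminant := by
  rw [frickeDiscriminant, show (24 : ℤ) = 12 + 12 by norm_num,
    mul_slash_of_mem_frickeGroup hg]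
  rcases levelOne_slash_frickeW_slash discriminant_slash hg with ⟨h1, h2⟩ | ⟨h1, h2⟩
  · rw [h1, h2]
  · rw [h1, h2, mul_comm]

theorem mdifferentiable_frickeDiscriminant : MDiff frickeDiscriminant :=
  CuspForm.discriminant.holo'.mul (CuspForm.discriminant.holo'.slash _ _)

/-- `Δ(z)` decays no faster than `q` and `Δ(2z)` no faster than `q²`. -/
theorem isBigO_frickeDiscriminant :
    (fun τ : ℍ ↦ Real.exp (-2 * Real.pi * τ.im) ^ 3) =O[atImInfty] frickeDiscriminant := by
  have h1 := ModularForm.exp_isBigO_discriminant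
  have h2 := h1.comp_tendsto (tendsto_natMulUHP 2)
  have h3 : (fun τ : ℍ ↦ Real.exp (-2 * Real.pi * τ.im) ^ 2) =O[atImInfty]
      (ModularForm.discriminant ∣[(12 : ℤ)] frickeW 2) := by
    refine (h2.const_mul_right (c := (64 : ℂ)) (by norm_num)).congr (fun z ↦ ?_) (fun z ↦ ?_)
    · have : (natMulUHP 2 z).im = 2 * z.im := by
        change (((2 : ℕ) : ℂ) * z).im = _
        simp
      simp only [Function.comp_apply, this, ← Real.exp_nat_mul]
      ring_nf
    · rw [discriminant_slash_frickeW]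
      rfl
  exact (h1.mul h3).congr (fun z ↦ by ring) (fun z ↦ rfl)

/-! ### Zeros of `Δ₂` and division by it -/

theorem frickeDelta_mem_cuspForms : frickeDelta ∈ frickeCuspForms 2 8 := by
  obtain ⟨h4, l4⟩ := frickeE_mem (k := 4) (by norm_num) (by decide)
  obtain ⟨h8, l8⟩ := frickeE_mem (k := 8) (by norm_num) (by decide)
  have h44 := mul_mem_frickeModularForms h4 h4
  rw [mem_frickeCuspForms_iff]
  norm_num at h44 h4 h8 l4 l8
  constructor
  · rw [frickeDelta, sq]
    exact Submodule.smul_mem _ _ (Submodule.sub_mem _ h44 h8)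
  · have := ((l4.pow 2).sub l8).const_mul (17 / 1152 : ℂ)
    norm_num at this
    exact this

theorem qParam_natMulUHP_two (z : ℍ) :
    Function.Periodic.qParam 1 (natMulUHP 2 z) = Function.Periodic.qParam 1 z ^ 2 := by
  simp only [Function.Periodic.qParam, natMulUHP, ← Complex.exp_nat_mul]
  congr 1
  push_cast
  ring

theorem hasDerivAt_cuspFunction_E {k : ℕ} (hk : 3 ≤ k) (hk2 : Even k) :
    HasDerivAt (UpperHalfPlane.cuspFunction 1 (ModularForm.E hk)) (-(2 * k / bernoulli k)) 0 := by
  have h := ModularFormClass.analyticAt_cuspFunction_zero (ModularForm.E hk) one_pos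
    one_mem_strictPeriods_SL
  have h1 := EisensteinSeries.E_qExpansion_coeff hk hk2 1
  simp [qExpansion_coeff] at h1
  rw [← h1]
  exact h.differentiableAt.hasDerivAt

theorem cuspFunction_E_zero {k : ℕ} (hk : 3 ≤ k) (hk2 : Even k) :
    UpperHalfPlane.cuspFunction 1 (ModularForm.E hk) 0 = 1 := by
  simpa [qExpansion_coeff] using EisensteinSeries.E_qExpansion_coeff_zero hk hk2

/-- The coefficient of `q` in `(E*_{4,2})² - E*_{8,2}` is `2 · 240/5 - 480/17 = 1152/17`, which also
explains the normalising constant of `Δ₂`. -/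
theorem frickeDelta_ne_zero : frickeDelta ≠ 0 := by
  intro h0
  have h3 : (3 : ℕ) ≤ 4 := by norm_num
  have h3' : (3 : ℕ) ≤ 8 := by norm_num
  set F := UpperHalfPlane.cuspFunction 1 (ModularForm.E h3) with hF
  set G := UpperHalfPlane.cuspFunction 1 (ModularForm.E h3') with hG
  have dF : HasDerivAt F 240 0 := by
    convert! hasDerivAt_cuspFunction_E h3 (by decide) using 1
    norm_num [show bernoulli 4 = -1 / 30 by decide +kernel]
  have dG : HasDerivAt G 480 0 := by
    convert! hasDerivAt_cuspFunction_E h3' (by decide) using 1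
    norm_num [show bernoulli 8 = -1 / 30 by decide +kernel]
  have F0 : F 0 = 1 := cuspFunction_E_zero h3 (by decide)
  have G0 : G 0 = 1 := cuspFunction_E_zero h3' (by decide)
  have hFz : ∀ z : ℍ, F (Function.Periodic.qParam 1 z) = eisE 4 z := fun z ↦ by
    rw [show (4 : ℤ) = (4 : ℕ) from rfl, eisE_eq_E h3]
    exact SlashInvariantFormClass.eq_cuspFunction _ z one_mem_strictPeriods_SL one_ne_zero
  have hGz : ∀ z : ℍ, G (Function.Periodic.qParam 1 z) = eisE 8 z := fun z ↦ by
    rw [show (8 : ℤ) = (8 : ℕ) from rfl, eisE_eq_E h3']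
    exact SlashInvariantFormClass.eq_cuspFunction _ z one_mem_strictPeriods_SL one_ne_zero
  -- Passing from `z` to `2z` replaces `q` by `q²`, so these terms contribute nothing to the linear
  -- coefficient.
  have hsq : HasDerivAt (fun q : ℂ ↦ q ^ 2) 0 0 := by simpa using hasDerivAt_pow 2 (0 : ℂ)
  have dF2 : HasDerivAt (fun q ↦ F (q ^ 2)) 0 0 := by
    simpa using! HasDerivAt.comp (h₂ := F) (h₂' := 240) 0 (by simpa using dF) hsq
  have dG2 : HasDerivAt (fun q ↦ G (q ^ 2)) 0 0 := by
    simpa using! HasDerivAt.comp (h₂ := G) (h₂' := 480) 0 (by simpa using dG) hsq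
  have dH := ((((dF2.const_mul 4).add dF).const_mul (1 / 5)).pow 2).sub
    (((dG2.const_mul 16).add dG).const_mul (1 / 17))
  -- Each `q` in the punctured unit disc comes from a point of `ℍ`, where `Δ₂ = 0` applies; at `q =
  -- 0` the constant terms cancel.
  have hz : ∀ᶠ q in 𝓝 (0 : ℂ), (1 / 5 * (4 * F (q ^ 2) + F q)) ^ 2 -
      1 / 17 * (16 * G (q ^ 2) + G q) = 0 := by
    filter_upwards [Metric.ball_mem_nhds (0 : ℂ) one_pos] with q hq
    by_cases hq0 : q = 0
    · subst hq0
      norm_num [F0, G0]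
    · have him := Function.Periodic.im_invQParam_pos_of_norm_lt_one one_pos
        (by simpa using hq) hq0
      have hqz : Function.Periodic.qParam 1 ((⟨_, him⟩ : ℍ) : ℂ) = q :=
        Function.Periodic.qParam_right_inv one_ne_zero hq0
      have := congrFun h0 ⟨_, him⟩
      simp only [frickeDelta, frickeE, Pi.smul_apply, Pi.sub_apply, Pi.pow_apply, smul_eq_mul,
        ← hFz, ← hGz, qParam_natMulUHP_two, hqz, Pi.zero_apply] at this
      norm_num at this ⊢
      exact this
  have h1 := (dH.congr_of_eventuallyEq (f₁ := fun _ ↦ 0)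
    (hz.mono fun q hq ↦ by simpa using hq.symm)).unique (hasDerivAt_const 0 (0 : ℂ))
  norm_num [F0, G0] at h1

/-- The cube of `Δ₂` is a nonzero multiple of `Δ · Δ|W`. -/
theorem exists_frickeDelta_pow_three :
    ∃ c : ℂ, c ≠ 0 ∧ ∀ z, frickeDelta z ^ 3 = c * frickeDiscriminant z := by
  have hD := frickeDelta_mem_cuspForms
  have hM := mem_frickeModularForms_iff.mp (mem_frickeCuspForms_iff.mp hD).1
  have hinv : ∀ g ∈ frickeGroup 2, (frickeDelta * frickeDelta * frickeDelta) ∣[(24 : ℤ)] g =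
      frickeDelta * frickeDelta * frickeDelta := fun g hg ↦ by
    rw [show (24 : ℤ) = 8 + 8 + 8 by norm_num, mul_slash_of_mem_frickeGroup hg,
      mul_slash_of_mem_frickeGroup hg, hM.1 g hg]
  have hq : frickeDelta * frickeDelta * frickeDelta / frickeDiscriminant ∈
      frickeModularForms 2 0 := by
    refine mem_frickeModularForms_iff.mpr ⟨fun g hg ↦ ?_, ?_, ?_⟩
    · rw [show (0 : ℤ) = 24 - 24 by norm_num, div_slash_of_mem_frickeGroup hg, hinv g hg,
        frickeDiscriminant_slash hg]
    · exact ((hM.2.1.mul hM.2.1).mul hM.2.1).div mdifferentiable_frickeDiscriminant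
        frickeDiscriminant_ne_zero
    -- As a cusp form `Δ₂` is `O(q)`, so its cube is `O(q³)`, which the weight 24 form dominates.
    · have hO := isBigO_exp_of_mem_frickeCuspForms hD
      have h3 : (frickeDelta * frickeDelta * frickeDelta) =O[atImInfty] frickeDiscriminant :=
        (((hO.mul hO).mul hO).congr (fun _ ↦ rfl) (fun _ ↦ by ring)).trans
          isBigO_frickeDiscriminant
      exact (Asymptotics.div_isBoundedUnder_of_isBigO h3).isBigO_one ℝ
  obtain ⟨c, hc⟩ := eq_const_of_mem_frickeModularForms_zero hq
  have key : ∀ z, frickeDelta z ^ 3 = c * frickeDiscriminant z := fun z ↦ by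
    have := congrFun hc z
    simp only [Pi.div_apply, Pi.mul_apply, Function.const_apply] at this
    rw [← this, div_mul_cancel₀ _ (frickeDiscriminant_ne_zero z)]
    ring
  refine ⟨c, ?_, key⟩
  rintro rfl
  refine frickeDelta_ne_zero (funext fun z ↦ ?_)
  simpa using key z

theorem frickeDelta_apply_ne_zero (z : ℍ) : frickeDelta z ≠ 0 := by
  obtain ⟨c, hc, h⟩ := exists_frickeDelta_pow_three
  intro h0
  have := h z
  rw [h0] at this
  exact mul_ne_zero hc (frickeDiscriminant_ne_zero z) (by simpa using this.symm)

theorem isBigO_frickeDelta :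
    (fun τ : ℍ ↦ Real.exp (-2 * Real.pi * τ.im)) =O[atImInfty] frickeDelta := by
  obtain ⟨c, hc, h⟩ := exists_frickeDelta_pow_three
  refine Asymptotics.IsBigO.of_pow (n := 3) (by norm_num) ?_
  refine (isBigO_frickeDiscriminant.const_mul_right hc).congr (fun _ ↦ rfl) (fun z ↦ ?_)
  simp [h z]

/-- A cusp form is `O(q)`, while `Δ₂` has no zeros and decays no faster than `q`, so the quotient is
holomorphic and bounded at the cusp. -/
theorem frickeCuspForms_eq_map (k : ℤ) :
    frickeCuspForms 2 k =
      (frickeModularForms 2 (k - 8)).map (LinearMap.mulLeft ℂ frickeDelta) := by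
  have hM := mem_frickeCuspForms_iff.mp frickeDelta_mem_cuspForms
  ext f
  rw [Submodule.mem_map]
  constructor
  · intro hf
    have hf' := mem_frickeModularForms_iff.mp (mem_frickeCuspForms_iff.mp hf).1
    have hM' := mem_frickeModularForms_iff.mp hM.1
    refine ⟨f / frickeDelta, mem_frickeModularForms_iff.mpr ⟨fun g hg ↦ ?_, ?_, ?_⟩, ?_⟩
    · rw [div_slash_of_mem_frickeGroup hg, hf'.1 g hg, hM'.1 g hg]
    · exact hf'.2.1.div hM'.2.1 frickeDelta_apply_ne_zero
    · exact (Asymptotics.div_isBoundedUnder_of_isBigO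
        ((isBigO_exp_of_mem_frickeCuspForms hf).trans isBigO_frickeDelta)).isBigO_one ℝ
    · ext z
      exact mul_div_cancel₀ _ (frickeDelta_apply_ne_zero z)
  · rintro ⟨g, hg, rfl⟩
    rw [LinearMap.mulLeft_apply, mem_frickeCuspForms_iff]
    refine ⟨by simpa using mul_mem_frickeModularForms hM.1 hg, ?_⟩
    obtain ⟨c, hc⟩ := exists_tendsto_of_mem_frickeModularForms hg
    have h0 : Tendsto frickeDelta atImInfty (𝓝 0) := hM.2
    have h1 := h0.mul hc
    rwa [zero_mul] at h1

/-! ### Splitting off the Eisenstein series -/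

theorem frickeE_mem_frickeModularForms {k : ℤ} (hk : Even k) (h : k = 0 ∨ 4 ≤ k) :
    frickeE 2 k ∈ frickeModularForms 2 k ∧ Tendsto (frickeE 2 k) atImInfty (𝓝 1) := by
  rcases h with rfl | h
  · rw [frickeE_zero]
    exact ⟨one_mem_frickeModularForms, tendsto_const_nhds⟩
  · lift k to ℕ using by omega
    exact frickeE_mem (by omega) (by exact_mod_cast hk)

theorem frickeModularForms_eq_sup {k : ℤ} (hk : Even k) (h : k = 0 ∨ 4 ≤ k) :
    frickeModularForms 2 k = Submodule.span ℂ {frickeE 2 k} ⊔ frickeCuspForms 2 k := by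
  obtain ⟨hE, lE⟩ := frickeE_mem_frickeModularForms hk h
  apply le_antisymm
  · intro f hf
    obtain ⟨c, hc⟩ := exists_tendsto_of_mem_frickeModularForms hf
    rw [Submodule.mem_sup]
    refine ⟨c • frickeE 2 k, Submodule.smul_mem _ _ (Submodule.mem_span_singleton_self _),
      f - c • frickeE 2 k, mem_frickeCuspForms_iff.mpr
        ⟨Submodule.sub_mem _ hf (Submodule.smul_mem _ _ hE), ?_⟩, by abel⟩
    have := hc.sub (lE.const_smul c)
    rwa [smul_eq_mul, mul_one, sub_self] at this
  · refine sup_le ?_ fun f hf ↦ (mem_frickeCuspForms_iff.mp hf).1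
    rw [Submodule.span_singleton_le_iff_mem]
    exact hE

theorem frickeE_ne_zero {k : ℤ} (hk : Even k) (h : k = 0 ∨ 4 ≤ k) : frickeE 2 k ≠ 0 := by
  intro h0
  have lE := (frickeE_mem_frickeModularForms hk h).2
  rw [h0] at lE
  exact zero_ne_one (tendsto_nhds_unique tendsto_const_nhds lE)

theorem span_frickeE_inf_frickeCuspForms {k : ℤ} (hk : Even k) (h : k = 0 ∨ 4 ≤ k) :
    Submodule.span ℂ {frickeE 2 k} ⊓ frickeCuspForms 2 k = ⊥ := by
  have lE := (frickeE_mem_frickeModularForms hk h).2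
  rw [eq_bot_iff]
  rintro f ⟨h1, h2⟩
  obtain ⟨c, rfl⟩ := Submodule.mem_span_singleton.mp h1
  have h3 : Tendsto (c • frickeE 2 k) atImInfty (𝓝 0) := (mem_frickeCuspForms_iff.mp h2).2
  have h4 := tendsto_nhds_unique h3 (lE.const_smul c)
  rw [smul_eq_mul, mul_one] at h4
  rw [← h4, zero_smul]
  exact zero_mem _

theorem frickeModularForms_eq_span {k : ℤ} (hk : Even k) (h : k = 0 ∨ 4 ≤ k)
    (h0 : frickeCuspForms 2 k = ⊥) : frickeModularForms 2 k = Submodule.span ℂ {frickeE 2 k} := by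
  rw [frickeModularForms_eq_sup hk h, h0, sup_bot_eq]

theorem frickeCuspForms_eq_bot {k : ℤ} (h : frickeModularForms 2 (k - 8) = ⊥) :
    frickeCuspForms 2 k = ⊥ := by
  rw [frickeCuspForms_eq_map, h, Submodule.map_bot]

/-! ### Vanishing in weight two -/

/-- On the imaginary axis `q` is a positive real and the coefficients `240 σ₃(n)` of `E_4` are
positive. -/
theorem one_le_re_eisE_four {z : ℍ} (hz : z.re = 0) : 1 ≤ (eisE 4 z).re := by
  have h3 : (3 : ℕ) ≤ 4 := by norm_num
  have hexp : Complex.exp (2 * Real.pi * Complex.I * z) =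
      (Real.exp (-(2 * Real.pi * z.im)) : ℝ) := by
    have : (z : ℂ) = Complex.I * z.im := by
      apply Complex.ext <;> simp [hz]
    rw [this, Complex.ofReal_exp]
    congr 1
    push_cast
    linear_combination (2 * Real.pi * z.im : ℂ) * Complex.I_mul_I
  have hsum : eisE 4 z = ((1 + 240 * ∑' n : ℕ+, (ArithmeticFunction.sigma 3 n : ℝ) *
      Real.exp (-(2 * Real.pi * z.im)) ^ (n : ℤ) : ℝ) : ℂ) := by
    rw [show (4 : ℤ) = (4 : ℕ) from rfl, eisE_eq_E h3,
      EisensteinSeries.q_expansion_bernoulli h3 (by decide), hexp]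
    push_cast
    norm_num [show bernoulli 4 = -1 / 30 by decide +kernel]
  rw [hsum, Complex.ofReal_re]
  have : 0 ≤ ∑' n : ℕ+, (ArithmeticFunction.sigma 3 n : ℝ) *
      Real.exp (-(2 * Real.pi * z.im)) ^ (n : ℤ) := tsum_nonneg fun n ↦ by positivity
  linarith

theorem frickeE_four_ne_zero {z : ℍ} (hz : z.re = 0) : frickeE 2 4 z ≠ 0 := by
  have h1 := one_le_re_eisE_four hz
  have h2 : 1 ≤ (eisE 4 (natMulUHP 2 z)).re := one_le_re_eisE_four (by
    change (((2 : ℕ) : ℂ) * z).re = 0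
    simp [hz])
  intro h
  have : 4 * eisE 4 (natMulUHP 2 z) + eisE 4 z = 0 := by
    norm_num [frickeE] at h
    exact h
  have h3 := congrArg Complex.re this
  simp at h3
  linarith

/-- The fixed point `i/√2` of the Fricke involution. -/
noncomputable def frickeFixedPoint : ℍ :=
  ⟨Complex.I / √2, by simp⟩

theorem frickeW_smul_frickeFixedPoint : frickeW 2 • frickeFixedPoint = frickeFixedPoint := by
  have hs : ((√2 : ℝ) : ℂ) ≠ 0 := by simp
  have hq : ((√2 : ℝ) : ℂ) ^ 2 = 2 := by
    rw [← Complex.ofReal_pow, Real.sq_sqrt (by norm_num)]; simp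
  rw [frickeW_smul]
  apply UpperHalfPlane.ext
  rw [modular_S_smul]
  simp only [natMulUHP, frickeFixedPoint]
  push_cast
  field_simp
  rw [Complex.I_sq, hq]
  ring

/-- The automorphy factor of `W` at its fixed point is `√2 · i/√2 = i`, so invariance in weight 2
reads `f = i⁻² f = -f`. -/
theorem apply_frickeFixedPoint_eq_zero {f : ℍ → ℂ} (hf : f ∈ frickeModularForms 2 2) :
    f frickeFixedPoint = 0 := by
  have hs : ((√2 : ℝ) : ℂ) ≠ 0 := by simp
  have h := congrFun ((mem_frickeModularForms_iff.mp hf).1 _ (frickeW_mem_frickeGroup 2))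
    frickeFixedPoint
  rw [slash_frickeW_apply, frickeW_smul_frickeFixedPoint, frickeFixedPoint,
    mul_div_cancel₀ _ hs, zpow_neg, zpow_two, Complex.I_mul_I] at h
  rw [frickeFixedPoint]
  norm_num at h
  linear_combination (-1 / 2 : ℂ) * h

/-- The square of a weight 2 form is a multiple of `E*_{4,2}` that vanishes where `E*_{4,2}` does
not, so the multiple is zero. -/
theorem frickeModularForms_two : frickeModularForms 2 2 = ⊥ := by
  rw [eq_bot_iff]
  intro f hf
  have h4 := mul_mem_frickeModularForms hf hf
  rw [show (2 + 2 : ℤ) = 4 by norm_num, frickeModularForms_eq_span (by decide) (by norm_num)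
    (frickeCuspForms_eq_bot (frickeModularForms_eq_bot_of_neg (by norm_num)))] at h4
  obtain ⟨c, hc⟩ := Submodule.mem_span_singleton.mp h4
  have h0 := congrFun hc frickeFixedPoint
  simp only [Pi.smul_apply, Pi.mul_apply, apply_frickeFixedPoint_eq_zero hf, smul_eq_mul,
    mul_zero] at h0
  have hre : frickeFixedPoint.re = 0 := by
    change (Complex.I / ((√2 : ℝ) : ℂ)).re = 0
    simp
  have hc0 := (mul_eq_zero.mp h0).resolve_right (frickeE_four_ne_zero hre)
  rw [Submodule.mem_bot]
  ext z
  have := congrFun hc z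
  rw [hc0, zero_smul] at this
  exact mul_self_eq_zero.mp this.symm

/-! ### Dimension formula -/

theorem mulLeft_frickeDelta_injective :
    Function.Injective (LinearMap.mulLeft ℂ frickeDelta) := fun f g h ↦ by
  ext z
  exact mul_left_cancel₀ (frickeDelta_apply_ne_zero z) (congrFun h z)

theorem finrank_frickeModularForms (k : ℕ) (hk : Even k) :
    FiniteDimensional ℂ (frickeModularForms 2 k) ∧
      Module.finrank ℂ (frickeModularForms 2 k) = if k % 8 = 2 then k / 8 else k / 8 + 1 := by
  induction k using Nat.strong_induction_on with | _ k ih =>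
  by_cases h2 : k = 2
  · subst h2
    rw [show ((2 : ℕ) : ℤ) = 2 from rfl, frickeModularForms_two]
    exact ⟨inferInstance, by simp⟩
  have hkZ : Even (k : ℤ) := by exact_mod_cast hk
  have hk4 : (k : ℤ) = 0 ∨ 4 ≤ (k : ℤ) := by grind
  -- The summand 1 counts the Eisenstein series. Both sides of the dimension formula shift by one
  -- from `k - 8` to `k`; for `k < 8` the residue 2 is excluded, as `k = 2` has been treated.
  have hstep : FiniteDimensional ℂ (frickeModularForms 2 ((k : ℤ) - 8)) ∧
      Module.finrank ℂ (frickeModularForms 2 ((k : ℤ) - 8)) + 1 =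
        if k % 8 = 2 then k / 8 else k / 8 + 1 := by
    by_cases h8 : k < 8
    · rw [frickeModularForms_eq_bot_of_neg (by omega), finrank_bot]
      refine ⟨inferInstance, ?_⟩
      split_ifs <;> omega
    · obtain ⟨h1, h3⟩ := ih (k - 8) (by omega) (by grind)
      rw [show ((k - 8 : ℕ) : ℤ) = (k : ℤ) - 8 by omega] at h1 h3
      refine ⟨h1, ?_⟩
      rw [h3]
      split_ifs <;> omega
  obtain ⟨hfd, hrank⟩ := hstep
  have hcfd : FiniteDimensional ℂ (frickeCuspForms 2 (k : ℤ)) := by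
    rw [frickeCuspForms_eq_map]
    infer_instance
  have hcr : Module.finrank ℂ (frickeCuspForms 2 (k : ℤ)) =
      Module.finrank ℂ (frickeModularForms 2 ((k : ℤ) - 8)) := by
    rw [frickeCuspForms_eq_map]
    exact (Submodule.equivMapOfInjective _ mulLeft_frickeDelta_injective _).finrank_eq.symm
  have hsum := Submodule.finrank_sup_add_finrank_inf_eq (Submodule.span ℂ {frickeE 2 k})
    (frickeCuspForms 2 (k : ℤ))
  rw [span_frickeE_inf_frickeCuspForms hkZ hk4, finrank_bot,
    finrank_span_singleton (frickeE_ne_zero hkZ hk4), hcr] at hsum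
  rw [frickeModularForms_eq_sup hkZ hk4]
  exact ⟨inferInstance, by omega⟩

theorem floor_intCast_div_eight (k : ℤ) : ⌊(k : ℝ) / 8⌋ = k / 8 := by
  rw [Int.floor_eq_iff, le_div_iff₀ (by norm_num), div_lt_iff₀ (by norm_num)]
  have h : k / 8 * 8 ≤ k ∧ k < (k / 8 + 1) * 8 := by omega
  exact ⟨by exact_mod_cast h.1, by exact_mod_cast h.2⟩

theorem mainTheorem5 (k : ℤ) (hk : Even k) :
    (k < 0 ∨ k = 2 → frickeModularForms 2 k = ⊥) ∧
    (k = 0 ∨ k = 4 ∨ k = 6 ∨ k = 10 →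
      frickeCuspForms 2 k = ⊥ ∧
      Module.finrank ℂ (frickeModularForms 2 k) = 1 ∧
      frickeModularForms 2 k = Submodule.span ℂ {frickeE 2 k}) ∧
    (frickeCuspForms 2 k =
      (frickeModularForms 2 (k - 8)).map (LinearMap.mulLeft ℂ frickeDelta)) ∧
    (0 ≤ k →
      FiniteDimensional ℂ (frickeModularForms 2 k) ∧
      (k ≡ 2 [ZMOD 8] → (Module.finrank ℂ (frickeModularForms 2 k) : ℤ) = ⌊(k : ℝ) / 8⌋) ∧
      (¬ k ≡ 2 [ZMOD 8] →
        (Module.finrank ℂ (frickeModularForms 2 k) : ℤ) = ⌊(k : ℝ) / 8⌋ + 1)) := by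
  refine ⟨?_, ?_, frickeCuspForms_eq_map k, ?_⟩
  · rintro (h | rfl)
    · exact frickeModularForms_eq_bot_of_neg h
    · exact frickeModularForms_two
  · intro h
    have h0 : k = 0 ∨ 4 ≤ k := by omega
    have hc : frickeCuspForms 2 k = ⊥ := by
      apply frickeCuspForms_eq_bot
      by_cases h10 : k = 10
      · rw [h10]
        exact frickeModularForms_two
      · exact frickeModularForms_eq_bot_of_neg (by omega)
    refine ⟨hc, ?_, frickeModularForms_eq_span hk h0 hc⟩
    rw [frickeModularForms_eq_span hk h0 hc]
    exact finrank_span_singleton (frickeE_ne_zero hk h0)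
  · intro h
    rw [floor_intCast_div_eight]
    lift k to ℕ using h
    obtain ⟨h1, h2⟩ := finrank_frickeModularForms k (by exact_mod_cast hk)
    refine ⟨h1, fun h3 ↦ ?_, fun h3 ↦ ?_⟩
    · rw [Int.ModEq] at h3
      rw [h2, if_pos (by omega)]
      omega
    · rw [Int.ModEq] at h3
      rw [h2, if_neg (by omega)]
      omega
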